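/- Let $\Sigma$ be a finite alphabet and $L\subseteq\Sigma^*$. Put $u^{-1}L=\{w: uw\in L\}$, $L^r=\{w^r : w\in L\}$ where $w^r$ is the reversal of the word $w$, and $\mathsf{LD}(L)=\{u^{-1}L: u\in\Sigma^*\}$. Let $\mathsf{SLD}(L)$, $\mathsf{BLD}(L)$ and $\mathsf{BLRD}(L)$ be the closures of $\mathsf{LD}(L)$ under, respectively, finite unions (including the empty one); all set-theoretic boolean operations; all set-theoretic boolean operations and two-sided derivatives $K\mapsto x^{-1}Ky^{-1}=\{w : xwy\in K\}$. The dependency relation of $L$ is $\mathcal{DR}_L\subseteq \mathsf{LD}(L)\times\mathsf{LD}(L^r)$ with $\mathcal{DR}_L(u^{-1}L,v^{-1}L^r)$ iff $uv^r\in L$. The bipartite dimension $\dim\mathcal R$ of a relation $\mathcal R\subseteq X\times Y$ is the minimum cardinality of a set of bicliques (subsets $B_1\times B_2\subseteq\mathcal R$ with $B_1\subseteq X$, $B_2\subseteq Y$) with union $\mathcal R$. For a regular language $L$, let $\mathrm{ns}(L)$ be the least number of states of a nondeterministic finite automaton (with arbitrary sets of initial and final states, possibly with no states) accepting $L$. Let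 $n_a(L)$ (resp. $n_\mu(L)$) be the least number of states of such an automaton accepting $L$ in which each state accepts a language from $\mathsf{BLD}(L)$ (resp. $\mathsf{BLRD}(L)$). A finite semilattice is a finite poset in which all finite subsets (including the empty one) have joins, and morphisms are the maps preserving finite joins. A morphism is nuclear if it is a composite $S\to D\to T$ of morphisms with $D$ a finite distributive lattice. A regular language $L$ is nuclear if for all $a\in\Sigma$ the morphism $\mathsf{SLD}(L)\to\mathsf{SLD}(L)$, $K\mapsto a^{-1}K$, is nuclear, where $\mathsf{SLD}(L)$ is ordered by inclusion. For a finite semilattice $S$, let $J(S)$ be the set of all $j\in S$ such that $j=\bigvee X$ implies $j\in X$ for every $X\subseteq S$, and let $M(S)$ be the set of all $m\in S$ such that $m=\bigwedge X$ implies $m\in X$ for every $X\subseteq S$. The lattice language $L(S)$ is the set of all words over the disjoint union $\{\langle j| : j\in J(S)\}\cup\{|m\rangle : m\in M(S)\}$ that contain no factor $\langle j|\,|m\rangle$ with $j\leq_S m$. **Proposition.** 1. If $L$ is a nuclear language, then $\mathrm{ns}(L)=\dim \mathcal{DR}_L$. 2. If $L=L(S)$ is the lattice language of a finite semilattice $S$,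 then $n_a(L)=n_\mu(L)=\mathrm{ns}(L)=\dim\mathcal{DR}_L$. All these numbers are finite. -/

import Mathlib

namespace SubatomicNFA

universe u v

section Derivatives

variable {α : Type u}

/-- The set of left derivatives `u⁻¹L = {w | u ++ w ∈ L}` of `L`. -/
def LD (L : Language α) : Set (Language α) := Set.range L.leftQuotient

/-- The two-sided derivative `x⁻¹Ky⁻¹ = {w | x ++ w ++ y ∈ K}`. -/
def twoSidedDerivative (K : Language α) (x y : List α) : Language α :=
  {w : List α | x ++ w ++ y ∈ K}

/-- The closure of the left derivatives of `L` under finite unions (including the empty union). -/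
def SLD (L : Language α) : Set (Language α) :=
  {K | ∃ F : Set (Language α), F.Finite ∧ F ⊆ LD L ∧ K = sSup F}

/-- The closure of the left derivatives of `L` under all set-theoretic boolean operations. -/
def BLD (L : Language α) : BooleanSubalgebra (Language α) :=
  BooleanSubalgebra.closure (LD L)

/-- The closure of the left derivatives of `L` under all set-theoretic boolean operations and
two-sided derivatives. -/
def BLRD (L : Language α) : BooleanSubalgebra (Language α) :=
  sInf {B | LD L ⊆ B ∧ ∀ K ∈ B, ∀ x y : List α, twoSidedDerivative K x y ∈ B}

theorem mem_sSup_language (F : Set (Language α)) (w : List α) :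
    w ∈ sSup F ↔ ∃ K ∈ F, w ∈ K :=
  Set.mem_sUnion

theorem leftQuotient_sSup (F : Set (Language α)) (x : List α) :
    (sSup F).leftQuotient x = sSup ((fun K : Language α => K.leftQuotient x) '' F) := by
  ext w
  simp only [Language.mem_leftQuotient, mem_sSup_language, Set.exists_mem_image]

theorem bot_mem_SLD (L : Language α) : (⊥ : Language α) ∈ SLD L :=
  ⟨∅, Set.finite_empty, Set.empty_subset _, sSup_empty.symm⟩

theorem sup_mem_SLD (L : Language α) {K₁ K₂ : Language α} (h₁ : K₁ ∈ SLD L) (h₂ : K₂ ∈ SLD L) :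
    K₁ ⊔ K₂ ∈ SLD L := by
  obtain ⟨F₁, f₁, s₁, rfl⟩ := h₁
  obtain ⟨F₂, f₂, s₂, rfl⟩ := h₂
  exact ⟨F₁ ∪ F₂, f₁.union f₂, Set.union_subset s₁ s₂, sSup_union.symm⟩

theorem leftQuotient_mem_SLD (L : Language α) {K : Language α} (h : K ∈ SLD L) (x : List α) :
    K.leftQuotient x ∈ SLD L := by
  obtain ⟨F, f, s, rfl⟩ := h
  refine ⟨_, f.image fun K : Language α => K.leftQuotient x, ?_, leftQuotient_sSup F x⟩
  rintro _ ⟨K, hK, rfl⟩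
  obtain ⟨y, rfl⟩ := s hK
  exact ⟨y ++ x, Language.leftQuotient_append L y x⟩

/-- `SLD L` is a join-semilattice with respect to union, ordered by inclusion. -/
instance instSemilatticeSupSLD (L : Language α) : SemilatticeSup (SLD L) :=
  Subtype.semilatticeSup fun _ _ h₁ h₂ => sup_mem_SLD L h₁ h₂

/-- The least element of `SLD L` is the empty language. -/
instance instOrderBotSLD (L : Language α) :
    @OrderBot (SLD L) (instSemilatticeSupSLD L).toPartialOrder.toLE where
  bot := ⟨⊥, bot_mem_SLD L⟩
  bot_le K := bot_le (a := (K : Language α))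

/-- The transition morphism `K ↦ a⁻¹K` of the minimal semilattice automaton `SLD L`. -/
def transition (L : Language α) (a : α) : SupBotHom (SLD L) (SLD L) where
  toFun K := ⟨(K : Language α).leftQuotient [a], leftQuotient_mem_SLD L K.2 [a]⟩
  map_sup' _ _ := Subtype.ext rfl
  map_bot' := Subtype.ext rfl

end Derivatives

section Nuclear

/-- A morphism of finite join-semilattices (preserving all finite joins, including the empty one)
is nuclear if it factorizes through a finite distributive lattice. -/
def IsNuclearHom {S : Type u} {T : Type v} [SemilatticeSup S] [OrderBot S] [SemilatticeSup T]
    [OrderBot T] (f : SupBotHom S T) : Prop :=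
  ∃ (D : Type) (_ : DistribLattice D) (_ : OrderBot D) (_ : Finite D)
    (g : SupBotHom S D) (h : SupBotHom D T), f = h.comp g

/-- A regular language is nuclear if all transition morphisms of its minimal semilattice automaton
are nuclear. -/
def IsNuclear {α : Type u} (L : Language α) : Prop :=
  L.IsRegular ∧ ∀ a : α, IsNuclearHom (transition L a)

end Nuclear

section Dimension

/-- A biclique of a relation `R ⊆ X × Y` is a subset of `R` of the form `B₁ × B₂`. -/
def IsBiclique {X : Type u} {Y : Type v} (R B : Set (X × Y)) : Prop :=
  B ⊆ R ∧ ∃ (B₁ : Set X) (B₂ : Set Y), B = B₁ ×ˢ B₂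

/-- A set of bicliques of `R` whose union is `R`. -/
def IsBicliqueCover {X : Type u} {Y : Type v} (R : Set (X × Y)) (C : Set (Set (X × Y))) : Prop :=
  (∀ B ∈ C, IsBiclique R B) ∧ ⋃₀ C = R

/-- The bipartite dimension of `R`: the minimum cardinality of a biclique cover. -/
noncomputable def bipartiteDim {X : Type u} {Y : Type v} (R : Set (X × Y)) : ℕ∞ :=
  ⨅ (C : Set (Set (X × Y))) (_ : IsBicliqueCover R C), C.encard

variable {α : Type u}

/-- The dependency relation of `L`, relating `x⁻¹L` and `y⁻¹Lʳ` iff `x yʳ ∈ L`. -/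
def DR (L : Language α) : Set (LD L × LD L.reverse) :=
  {p | ∃ x y : List α, p.1.1 = L.leftQuotient x ∧ p.2.1 = L.reverse.leftQuotient y ∧
    x ++ y.reverse ∈ L}

/-- The dependency relation does not depend on the words that represent the derivatives. -/
theorem mem_DR_iff (L : Language α) (x y : List α) :
    ((⟨L.leftQuotient x, x, rfl⟩, ⟨L.reverse.leftQuotient y, y, rfl⟩) : LD L × LD L.reverse) ∈ DR L
      ↔ x ++ y.reverse ∈ L := by
  have key : ∀ a b : List α, b ++ a.reverse ∈ L.reverse ↔ a ++ b.reverse ∈ L := fun a b => by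
    rw [Language.mem_reverse, List.reverse_append, List.reverse_reverse]
  constructor
  · rintro ⟨x', y', hx, hy, h⟩
    have h1 : y'.reverse ∈ L.leftQuotient x := by
      have hx' : L.leftQuotient x = L.leftQuotient x' := hx
      rw [hx']
      exact h
    have h2 : x.reverse ∈ L.reverse.leftQuotient y := by
      have hy' : L.reverse.leftQuotient y = L.reverse.leftQuotient y' := hy
      rw [hy']
      exact (key x y').2 h1
    exact (key x y).1 h2
  · exact fun h => ⟨x, y, rfl, rfl, h⟩

end Dimension

section Complexity

variable {α : Type u}

/-- The nondeterministic state complexity: the least number of states of an nfa accepting `L`. -/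
noncomputable def ns (L : Language α) : ℕ∞ :=
  ⨅ (Q : Type) (_ : Finite Q) (N : NFA α Q) (_ : N.accepts = L), ENat.card Q

/-- Every state of the nfa accepts a language from `BLD L`. -/
def IsAtomic {Q : Type} (N : NFA α Q) (L : Language α) : Prop :=
  ∀ q : Q, N.acceptsFrom {q} ∈ BLD L

/-- Every state of the nfa accepts a language from `BLRD L`. -/
def IsSubatomic {Q : Type} (N : NFA α Q) (L : Language α) : Prop :=
  ∀ q : Q, N.acceptsFrom {q} ∈ BLRD L

/-- The nondeterministic atomic complexity: the least number of states of an atomic nfa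
accepting `L`. -/
noncomputable def nAtomic (L : Language α) : ℕ∞ :=
  ⨅ (Q : Type) (_ : Finite Q) (N : NFA α Q) (_ : N.accepts = L) (_ : IsAtomic N L), ENat.card Q

/-- The nondeterministic syntactic complexity: the least number of states of a subatomic nfa
accepting `L`. -/
noncomputable def nSyntactic (L : Language α) : ℕ∞ :=
  ⨅ (Q : Type) (_ : Finite Q) (N : NFA α Q) (_ : N.accepts = L) (_ : IsSubatomic N L), ENat.card Q

end Complexity

section LatticeLanguage

variable (S : Type u) [SemilatticeSup S]

/-- The join-irreducible elements: `j = ⋁ X` implies `j ∈ X` for every subset `X`. -/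
def joinIrreducibles : Set S := {j | ∀ X : Set S, IsLUB X j → j ∈ X}

/-- The meet-irreducible elements: `m = ⋀ X` implies `m ∈ X` for every subset `X`. -/
def meetIrreducibles : Set S := {m | ∀ X : Set S, IsGLB X m → m ∈ X}

/-- The disjoint union of the join-irreducibles and the meet-irreducibles. -/
abbrev LatticeAlphabet : Type u := joinIrreducibles S ⊕ meetIrreducibles S

/-- The language of all words having no factor `⟨j| |m⟩` with `j ≤ m`. -/
def latticeLanguage : Language (LatticeAlphabet S) :=
  {w : List (LatticeAlphabet S) | ∀ (j : joinIrreducibles S) (m : meetIrreducibles S),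
    (j : S) ≤ m → ¬ [Sum.inl j, Sum.inr m] <:+: w}

end LatticeLanguage

end SubatomicNFA

/-!
The bipartite dimension of `DR L` is the least size of a family of languages such that every left
derivative of `L` is a union of members of the family. Such a family is read off a biclique cover,
one language for each biclique, and the languages accepted by the states of an nfa for `L` form one.

Conversely, let `β` be such a family, indexed by `Q`, and let each transition `K ↦ a⁻¹K` of `SLD L`
factorize as `h a ∘ g a` through a finite distributive lattice. Then there is an nfa on `Q` whose
states `q` with `β q ⊆ K` jointly accept `K`, for every `K` in `SLD L`. An element `j ≤ g a K` that
is join-prime is below `g a K'` for all `K' ⊇ β q`, for a single state `q` with `β q ⊆ K`; from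
there, reading `a`, the nfa moves to the states `q'` with `β q' ⊆ h a j`. Since `g a K` is a join of
primes, this loses nothing.

The lattice language is given by a condition on adjacent letters, so `a⁻¹K` is either empty or
`a⁻¹L`, and every transition factorizes through the two-element lattice. The state `q` then accepts
at least `β q`, and hence exactly `β q` if `β q` is an intersection of left derivatives.
-/

namespace SubatomicNFA

section Semilattices

variable {S T : Type*} [SemilatticeSup S] [OrderBot S] [SemilatticeSup T] [OrderBot T]

/-- A morphism of join-semilattices of rank at most one: it factorizes through the two-element
lattice, encoded as `Prop`. -/
def FactorsThroughProp (f : SupBotHom S T) : Prop :=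
  ∃ (g : SupBotHom S Prop) (h : SupBotHom Prop T), f = h.comp g

theorem FactorsThroughProp.finite_range {f : SupBotHom S T} (hf : FactorsThroughProp f) :
    (Set.range f).Finite := by
  obtain ⟨g, h, rfl⟩ := hf
  exact (Set.finite_range h).subset (Set.range_comp_subset_range g h)

theorem FactorsThroughProp.of_forall_eq_bot_or_eq {f : SupBotHom S T} {t : T}
    (hf : ∀ s, f s = ⊥ ∨ f s = t) : FactorsThroughProp f := by
  classical
  let g : SupBotHom S Prop :=
    { toFun s := f s ≠ ⊥
      map_sup' s s' := by simp [← not_and_or]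
      map_bot' := by simp }
  let h : SupBotHom Prop T :=
    { toFun p := if p then t else ⊥
      map_sup' p p' := by by_cases p <;> by_cases p' <;> simp [*]
      map_bot' := if_neg id }
  refine ⟨g, h, SupBotHom.ext fun s => ?_⟩
  have h_apply (p : Prop) : h p = if p then t else ⊥ := rfl
  change f s = h (f s ≠ ⊥)
  rw [h_apply]
  split_ifs with hs
  · exact (hf s).resolve_left hs
  · exact not_not.1 hs

theorem supPrime_prop_iff {p : Prop} : SupPrime p ↔ p := by
  rw [supPrime_iff_not_isMin, isMin_iff_eq_bot, Prop.bot_eq_false, eq_iff_iff, iff_false, not_not]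

end Semilattices

section LeftDerivatives

variable {α : Type*} {L : Language α}

theorem LD_subset_SLD (L : Language α) : LD L ⊆ SLD L := fun K hK =>
  ⟨{K}, Set.finite_singleton K, Set.singleton_subset_iff.2 hK, sSup_singleton.symm⟩

theorem mem_coe_finset_sup_SLD {ι : Type*} (s : Finset ι) (f : ι → SLD L) (w : List α) :
    w ∈ (s.sup f : SLD L).1 ↔ ∃ i ∈ s, w ∈ (f i).1 := by
  let coe : SupBotHom (SLD L) (Set (List α)) := ⟨⟨Subtype.val, fun _ _ => rfl⟩, rfl⟩
  have h_sup : coe (s.sup f) = ⋃ i ∈ s, coe (f i) := by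
    rw [map_finset_sup, Finset.sup_set_eq_biUnion]
    rfl
  exact (Set.ext_iff.1 h_sup w).trans (by simp only [Set.mem_iUnion₂, exists_prop]; rfl)

theorem finite_LD_of_finite_range_transition [Finite α]
    (hL : ∀ a, (Set.range (transition L a)).Finite) : (LD L).Finite := by
  refine ((Set.finite_singleton L).union
    (Set.finite_iUnion fun a => (hL a).image Subtype.val)).subset ?_
  rintro _ ⟨x, rfl⟩
  rcases List.eq_nil_or_concat' x with rfl | ⟨x, a, rfl⟩
  · exact Or.inl rfl
  · let K : SLD L := ⟨L.leftQuotient x, LD_subset_SLD L ⟨x, rfl⟩⟩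
    exact Or.inr (Set.mem_iUnion.2 ⟨a, transition L a K, ⟨K, rfl⟩,
      (Language.leftQuotient_append L x [a]).symm⟩)

/-- The intersection of all left derivatives of `L` containing `K`; it is the set of all words if
there are none. -/
def derivativeHull (L K : Language α) : Language α := sInf {M ∈ LD L | K ≤ M}

theorem le_derivativeHull (L K : Language α) : K ≤ derivativeHull L K := le_sInf fun _ hM => hM.2

theorem derivativeHull_le {K M : Language α} (hM : M ∈ LD L) (hKM : K ≤ M) :
    derivativeHull L K ≤ M := sInf_le ⟨hM, hKM⟩

theorem derivativeHull_derivativeHull (L K : Language α) :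
    derivativeHull L (derivativeHull L K) = derivativeHull L K :=
  (le_sInf fun _ hM => derivativeHull_le hM.1 (derivativeHull_le hM.1 hM.2)).antisymm
    (le_derivativeHull L _)

theorem derivativeHull_mem_BLD (hL : (LD L).Finite) (K : Language α) :
    derivativeHull L K ∈ BLD L :=
  (BLD L).infClosed.sInf_mem (hL.subset (Set.sep_subset _ _)) BooleanSubalgebra.top_mem
    ((Set.sep_subset _ _).trans BooleanSubalgebra.subset_closure)

theorem BLD_le_BLRD (L : Language α) : BLD L ≤ BLRD L :=
  le_sInf fun _ hB => BooleanSubalgebra.closure_le.2 hB.1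

end LeftDerivatives

section Generating

variable {α Q : Type*} {L : Language α} {β : Q → Language α}

/-- A family `β` of languages generates the left derivatives of `L` if each of them is the union of
the members of `β` that it contains. -/
def IsGenerating (L : Language α) (β : Q → Language α) : Prop :=
  ∀ K ∈ LD L, ∀ w ∈ K, ∃ q, β q ≤ K ∧ w ∈ β q

namespace IsGenerating

theorem exists_of_mem_SLD (hβ : IsGenerating L β) {K : Language α} (hK : K ∈ SLD L) {w : List α}
    (hw : w ∈ K) : ∃ q, β q ≤ K ∧ w ∈ β q := by
  obtain ⟨F, -, hF, rfl⟩ := hK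
  obtain ⟨M, hM, hwM⟩ := (mem_sSup_language F w).1 hw
  obtain ⟨q, hq, hwq⟩ := hβ M (hF hM) w hwM
  exact ⟨q, hq.trans (le_sSup hM), hwq⟩

theorem comp_surjective {P : Type*} {f : P → Q} (hβ : IsGenerating L β)
    (hf : Function.Surjective f) : IsGenerating L (β ∘ f) := fun K hK w hw =>
  hf.exists.1 (hβ K hK w hw)

theorem derivativeHull (hβ : IsGenerating L β) :
    IsGenerating L fun q => derivativeHull L (β q) := fun K hK w hw =>
  let ⟨q, hq, hwq⟩ := hβ K hK w hw
  ⟨q, derivativeHull_le hK hq, le_derivativeHull L _ hwq⟩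

theorem finite_LD [Finite Q] (hβ : IsGenerating L β) : (LD L).Finite := by
  refine Set.Finite.of_finite_image (f := fun K => {q | β q ≤ K}) (Set.toFinite _) ?_
  have le_of_eq : ∀ K ∈ LD L, ∀ M, {q | β q ≤ K} = {q | β q ≤ M} → K ≤ M := by
    intro K hK M hKM w hw
    obtain ⟨q, hq, hwq⟩ := hβ K hK w hw
    exact (hKM.subset hq : β q ≤ M) hwq
  exact fun K hK M hM hKM => (le_of_eq K hK M hKM).antisymm (le_of_eq M hM K hKM.symm)

end IsGenerating

theorem isGenerating_coe_LD (L : Language α) : IsGenerating L ((↑) : LD L → Language α) :=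
  fun K hK _ hw => ⟨⟨K, hK⟩, le_rfl, hw⟩

end Generating

section BipartiteDimension

variable {α : Type*} {L : Language α}

theorem IsGenerating.bipartiteDim_DR_le {Q : Type*} {β : Q → Language α} (hβ : IsGenerating L β) :
    bipartiteDim (DR L) ≤ ENat.card Q := by
  let B (q : Q) : Set (LD L × LD L.reverse) :=
    {K | β q ≤ K.1} ×ˢ {M | ∃ w ∈ β q, M.1 = L.reverse.leftQuotient w.reverse}
  have hB (q : Q) : B q ⊆ DR L := by
    rintro ⟨⟨_, x, rfl⟩, M⟩ ⟨hq, w, hw, hM⟩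
    exact ⟨x, w.reverse, rfl, hM, by rw [List.reverse_reverse]; exact hq hw⟩
  have hcover : IsBicliqueCover (DR L) (Set.range B) := by
    refine ⟨Set.forall_mem_range.2 fun q => ⟨hB q, _, _, rfl⟩, ?_⟩
    refine (Set.sUnion_subset (Set.forall_mem_range.2 hB)).antisymm ?_
    rintro ⟨K, M⟩ ⟨x, y, hx, hy, hxy⟩
    obtain ⟨q, hq, hyq⟩ := hβ K K.2 y.reverse (by rw [hx]; exact hxy)
    exact ⟨B q, ⟨q, rfl⟩, hq, y.reverse, hyq, by rwa [List.reverse_reverse]⟩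
  calc bipartiteDim (DR L) ≤ (Set.range B).encard := iInf₂_le _ hcover
    _ ≤ ENat.card Q := by
      rw [← Set.image_univ, ← Set.encard_univ]
      exact Set.encard_image_le _ _

theorem bipartiteDim_DR_ne_top (hL : (LD L).Finite) : bipartiteDim (DR L) ≠ ⊤ :=
  ne_top_of_le_ne_top hL.encard_lt_top.ne (isGenerating_coe_LD L).bipartiteDim_DR_le

/-- The language of a biclique of `DR L`: the words `w` such that the left derivative of `Lʳ` by
`wʳ` is in the right-hand side of the biclique. -/
def bicliqueLanguage (B : Set (LD L × LD L.reverse)) : Language α :=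
  {w | ∃ K, (K, ⟨L.reverse.leftQuotient w.reverse, w.reverse, rfl⟩) ∈ B}

theorem IsBiclique.bicliqueLanguage_le {B : Set (LD L × LD L.reverse)} (hB : IsBiclique (DR L) B)
    {K : LD L} {M : LD L.reverse} (hKM : (K, M) ∈ B) : bicliqueLanguage B ≤ K.1 := by
  obtain ⟨hBR, B₁, B₂, rfl⟩ := hB
  obtain ⟨_, x, rfl⟩ := K
  rintro w ⟨_, -, hw⟩
  have := (mem_DR_iff L x w.reverse).1 (hBR ⟨hKM.1, hw⟩)
  rwa [List.reverse_reverse] at this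

theorem IsBiclique.exists_bicliqueLanguage_le {B : Set (LD L × LD L.reverse)}
    (hB : IsBiclique (DR L) B) : ∃ K ∈ LD L, bicliqueLanguage B ≤ K := by
  rcases B.eq_empty_or_nonempty with rfl | ⟨⟨K, M⟩, hKM⟩
  · exact ⟨L, ⟨[], rfl⟩, by rintro w ⟨_, ⟨⟩⟩⟩
  · exact ⟨K, K.2, hB.bicliqueLanguage_le hKM⟩

theorem IsBicliqueCover.isGenerating {C : Set (Set (LD L × LD L.reverse))}
    (hC : IsBicliqueCover (DR L) C) : IsGenerating L fun B : C => bicliqueLanguage B.1 := by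
  rintro _ ⟨x, rfl⟩ w hw
  have hDR := (mem_DR_iff L x w.reverse).2 (by rwa [List.reverse_reverse])
  obtain ⟨B, hB, hxw⟩ := hC.2.superset hDR
  exact ⟨⟨B, hB⟩, (hC.1 B hB).bicliqueLanguage_le hxw, _, hxw⟩

theorem le_bipartiteDim_DR {n : ℕ∞}
    (hn : ∀ (Q : Type) [Finite Q] (β : Q → Language α), IsGenerating L β →
      (∀ q, ∃ K ∈ LD L, β q ≤ K) → n ≤ ENat.card Q) :
    n ≤ bipartiteDim (DR L) := by
  refine le_iInf₂ fun C hC => ?_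
  rcases C.finite_or_infinite with hfin | hinf
  · have := hfin.to_subtype
    obtain ⟨k, ⟨f⟩⟩ := Finite.exists_equiv_fin C
    exact (hn (Fin k) _ (hC.isGenerating.comp_surjective f.symm.surjective) fun i =>
      (hC.1 _ (f.symm i).2).exists_bicliqueLanguage_le).trans_eq (ENat.card_congr f).symm
  · exact hinf.encard_eq ▸ le_top

end BipartiteDimension

section StateComplexity

variable {α : Type*} {L : Language α}

theorem mem_acceptsFrom_iff_exists {Q : Type*} {N : NFA α Q} {X : Set Q} {w : List α} :
    w ∈ N.acceptsFrom X ↔ ∃ q ∈ X, w ∈ N.acceptsFrom {q} := by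
  simp only [NFA.mem_acceptsFrom, N.mem_evalFrom_iff_exists (S := X)]
  tauto

theorem isGenerating_acceptsFrom {Q : Type*} (N : NFA α Q) :
    IsGenerating N.accepts fun q => N.acceptsFrom {q} := by
  rintro _ ⟨x, rfl⟩ w hw
  have mem_iff (v : List α) :
      v ∈ N.accepts.leftQuotient x ↔ ∃ q ∈ N.eval x, v ∈ N.acceptsFrom {q} :=
    (N.append_mem_acceptsFrom).trans mem_acceptsFrom_iff_exists
  obtain ⟨q, hq, hwq⟩ := (mem_iff w).1 hw
  exact ⟨q, fun v hv => (mem_iff v).2 ⟨q, hq, hv⟩, hwq⟩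

theorem bipartiteDim_DR_le_ns (L : Language α) : bipartiteDim (DR L) ≤ ns L := by
  simp only [ns, le_iInf_iff]
  rintro Q _ N rfl
  exact (isGenerating_acceptsFrom N).bipartiteDim_DR_le

theorem ns_le_card {Q : Type} [Finite Q] {N : NFA α Q} (hN : N.accepts = L) :
    ns L ≤ ENat.card Q :=
  iInf_le_of_le Q <| iInf_le_of_le ‹_› <| iInf₂_le N hN

theorem nSyntactic_le_card {Q : Type} [Finite Q] {N : NFA α Q} (hN : N.accepts = L)
    (h : IsSubatomic N L) : nSyntactic L ≤ ENat.card Q :=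
  iInf_le_of_le Q <| iInf_le_of_le ‹_› <| iInf_le_of_le N <| iInf₂_le hN h

theorem nAtomic_le_card {Q : Type} [Finite Q] {N : NFA α Q} (hN : N.accepts = L)
    (h : IsAtomic N L) : nAtomic L ≤ ENat.card Q :=
  iInf_le_of_le Q <| iInf_le_of_le ‹_› <| iInf_le_of_le N <| iInf₂_le hN h

theorem ns_le_nSyntactic (L : Language α) : ns L ≤ nSyntactic L := by
  simp only [nSyntactic, le_iInf_iff]
  exact fun _ _ _ hN _ => ns_le_card hN

theorem nSyntactic_le_nAtomic (L : Language α) : nSyntactic L ≤ nAtomic L := by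
  simp only [nAtomic, le_iInf_iff]
  exact fun _ _ _ hN h => nSyntactic_le_card hN fun q => BLD_le_BLRD L (h q)

end StateComplexity

section NuclearNFA

variable {α Q : Type*} {L : Language α} {β : Q → Language α} {D : α → Type*}
  [∀ a, DistribLattice (D a)] [∀ a, OrderBot (D a)]
  {g : ∀ a, SupBotHom (SLD L) (D a)} {h : ∀ a, SupBotHom (D a) (SLD L)}

/-- The nfa on the index set of a generating family `β` that is induced by factorizations
`h a ∘ g a` of the transition morphisms of `SLD L`. -/
def nuclearNFA (β : Q → Language α) (g : ∀ a, SupBotHom (SLD L) (D a))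
    (h : ∀ a, SupBotHom (D a) (SLD L)) : NFA α Q where
  start := {q | β q ≤ L}
  accept := {q | [] ∈ β q}
  step q a := {q' | ∃ j, SupPrime j ∧ (∀ K : SLD L, β q ≤ K.1 → j ≤ g a K) ∧ β q' ≤ (h a j).1}

theorem IsGenerating.exists_forall_le_of_supPrime [Finite Q] {D : Type*} [SemilatticeSup D]
    [OrderBot D] (hβ : IsGenerating L β) (g : SupBotHom (SLD L) D) {j : D} (hj : SupPrime j)
    {K : SLD L} (hjK : j ≤ g K) : ∃ q, β q ≤ K.1 ∧ ∀ M : SLD L, β q ≤ M.1 → j ≤ g M := by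
  by_contra! hcon
  choose! M hM hjM using hcon
  let X : Finset Q := (Set.toFinite {q | β q ≤ K.1}).toFinset
  have mem_X {q : Q} : q ∈ X ↔ β q ≤ K.1 := Set.Finite.mem_toFinset _
  have hK : K ≤ X.sup M := fun w hw => by
    obtain ⟨q, hq, hwq⟩ := hβ.exists_of_mem_SLD K.2 hw
    exact (mem_coe_finset_sup_SLD X M w).2 ⟨q, mem_X.2 hq, hM q hq hwq⟩
  have hj_sup : j ≤ X.sup (g ∘ M) := map_finset_sup g X M ▸ hjK.trans (OrderHomClass.mono g hK)
  obtain ⟨q, hq, hjq⟩ := hj.le_finset_sup.1 hj_sup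
  exact hjM q (mem_X.1 hq) hjq

theorem mem_map_iff_exists_supPrime {D : Type*} [DistribLattice D] [OrderBot D] [Finite D]
    (h : SupBotHom D (SLD L)) (d : D) (w : List α) :
    w ∈ (h d).1 ↔ ∃ j, SupPrime j ∧ j ≤ d ∧ w ∈ (h j).1 := by
  constructor
  · intro hw
    obtain ⟨s, rfl, hs⟩ := exists_supIrred_decomposition d
    rw [map_finset_sup, mem_coe_finset_sup_SLD] at hw
    obtain ⟨j, hj, hwj⟩ := hw
    exact ⟨j, (hs hj).supPrime, Finset.le_sup (f := id) hj, hwj⟩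
  · rintro ⟨j, -, hjd, hwj⟩
    exact OrderHomClass.mono h hjd hwj

theorem mem_transition_iff (hgh : ∀ a, transition L a = (h a).comp (g a)) {a : α} {K : SLD L}
    {w : List α} : a :: w ∈ K.1 ↔ w ∈ (h a (g a K)).1 := by
  rw [← SupBotHom.comp_apply, ← hgh]
  rfl

theorem cons_mem_acceptsFrom_nuclearNFA {a : α} {w : List α} {X : Set Q} :
    a :: w ∈ (nuclearNFA β g h).acceptsFrom X ↔
      ∃ q ∈ X, ∃ j, SupPrime j ∧ (∀ K : SLD L, β q ≤ K.1 → j ≤ g a K) ∧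
        w ∈ (nuclearNFA β g h).acceptsFrom {q' | β q' ≤ (h a j).1} := by
  rw [NFA.cons_mem_acceptsFrom, mem_acceptsFrom_iff_exists]
  simp only [NFA.mem_stepSet, mem_acceptsFrom_iff_exists (X := {q' | β q' ≤ (h a _).1})]
  constructor
  · rintro ⟨q', ⟨q, hq, j, hj, hjq, hq'⟩, hw⟩
    exact ⟨q, hq, j, hj, hjq, q', hq', hw⟩
  · rintro ⟨q, hq, j, hj, hjq, q', hq', hw⟩
    exact ⟨q', ⟨q, hq, j, hj, hjq, hq'⟩, hw⟩

variable [Finite Q] [∀ a, Finite (D a)]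

theorem acceptsFrom_nuclearNFA (hβ : IsGenerating L β)
    (hgh : ∀ a, transition L a = (h a).comp (g a)) (K : SLD L) :
    (nuclearNFA β g h).acceptsFrom {q | β q ≤ K.1} = K.1 := by
  ext w
  induction w generalizing K with
  | nil =>
    rw [NFA.nil_mem_acceptsFrom]
    exact ⟨fun ⟨_, hq, hnil⟩ => hq hnil, fun hnil => hβ.exists_of_mem_SLD K.2 hnil⟩
  | cons a w ih =>
    simp only [cons_mem_acceptsFrom_nuclearNFA, ih]
    rw [mem_transition_iff hgh, mem_map_iff_exists_supPrime]
    constructor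
    · rintro ⟨q, hq, j, hj, hjq, hw⟩
      exact ⟨j, hj, hjq K hq, hw⟩
    · rintro ⟨j, hj, hjK, hw⟩
      obtain ⟨q, hq, hjq⟩ := hβ.exists_forall_le_of_supPrime (g a) hj hjK
      exact ⟨q, hq, j, hj, hjq, hw⟩

theorem accepts_nuclearNFA (hβ : IsGenerating L β)
    (hgh : ∀ a, transition L a = (h a).comp (g a)) : (nuclearNFA β g h).accepts = L :=
  acceptsFrom_nuclearNFA hβ hgh ⟨L, LD_subset_SLD L ⟨[], rfl⟩⟩

theorem acceptsFrom_singleton_nuclearNFA_le (hβ : IsGenerating L β)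
    (hgh : ∀ a, transition L a = (h a).comp (g a)) {q : Q} {K : SLD L} (hq : β q ≤ K.1) :
    (nuclearNFA β g h).acceptsFrom {q} ≤ K.1 := fun _ hw =>
  acceptsFrom_nuclearNFA hβ hgh K ▸ mem_acceptsFrom_iff_exists.2 ⟨q, hq, hw⟩

theorem ns_le_bipartiteDim_DR (hL : ∀ a, IsNuclearHom (transition L a)) :
    ns L ≤ bipartiteDim (DR L) := by
  choose D _ _ _ g h hgh using hL
  exact le_bipartiteDim_DR fun Q _ β hβ _ => ns_le_card (accepts_nuclearNFA hβ hgh)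

end NuclearNFA

section RankOneTransitions

variable {α : Type*} {L : Language α} {g : α → SupBotHom (SLD L) Prop}
  {h : α → SupBotHom Prop (SLD L)}

theorem le_acceptsFrom_singleton_nuclearNFA {Q : Type*} [Finite Q] {β : Q → Language α}
    (hβ : IsGenerating L β) (hgh : ∀ a, transition L a = (h a).comp (g a)) {q : Q} {M : SLD L}
    (hM : β q ≤ M.1) : β q ≤ (nuclearNFA β g h).acceptsFrom {q} := by
  rintro (_ | ⟨a, w⟩) hw
  · exact (NFA.nil_mem_acceptsFrom _).2 ⟨q, rfl, hw⟩
  · have g_and_mem (K : SLD L) (hK : β q ≤ K.1) : g a K ∧ w ∈ (h a True).1 := by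
      obtain ⟨j, hj, hjK, hwj⟩ :=
        (mem_map_iff_exists_supPrime _ _ _).1 ((mem_transition_iff hgh).1 (hK hw))
      obtain rfl : j = True := eq_true (supPrime_prop_iff.1 hj)
      exact ⟨hjK trivial, hwj⟩
    refine cons_mem_acceptsFrom_nuclearNFA.2 ⟨q, rfl, True, supPrime_prop_iff.2 trivial,
      fun K hK _ => (g_and_mem K hK).1, ?_⟩
    exact (acceptsFrom_nuclearNFA hβ hgh (h a True)).symm ▸ (g_and_mem M hM).2

theorem isAtomic_nuclearNFA {Q : Type} [Finite Q] {β : Q → Language α} (hβ : IsGenerating L β)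
    (hgh : ∀ a, transition L a = (h a).comp (g a)) (hβL : ∀ q, ∃ K ∈ LD L, β q ≤ K)
    (hhull : ∀ q, derivativeHull L (β q) = β q) : IsAtomic (nuclearNFA β g h) L := by
  intro q
  obtain ⟨M, hM, hqM⟩ := hβL q
  have h_le : (nuclearNFA β g h).acceptsFrom {q} ≤ derivativeHull L (β q) :=
    le_sInf fun K ⟨hK, hqK⟩ =>
      acceptsFrom_singleton_nuclearNFA_le hβ hgh (K := ⟨K, LD_subset_SLD L hK⟩) hqK
  have h_ge : β q ≤ (nuclearNFA β g h).acceptsFrom {q} :=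
    le_acceptsFrom_singleton_nuclearNFA hβ hgh (M := ⟨M, LD_subset_SLD L hM⟩) hqM
  have h_eq := h_le.antisymm ((hhull q).trans_le h_ge)
  exact h_eq ▸ derivativeHull_mem_BLD hβ.finite_LD (β q)

theorem nAtomic_le_bipartiteDim_DR (hL : ∀ a, FactorsThroughProp (transition L a)) :
    nAtomic L ≤ bipartiteDim (DR L) := by
  choose g h hgh using hL
  refine le_bipartiteDim_DR fun Q _ β hβ hβL => ?_
  refine nAtomic_le_card (accepts_nuclearNFA hβ.derivativeHull hgh)
    (isAtomic_nuclearNFA hβ.derivativeHull hgh (fun q => ?_) fun q => ?_)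
  · obtain ⟨K, hK, hqK⟩ := hβL q
    exact ⟨K, hK, derivativeHull_le hK hqK⟩
  · exact derivativeHull_derivativeHull L (β q)

end RankOneTransitions

section ChainLanguages

variable {α : Type*}

/-- The language of all words whose consecutive letters are related by `R`. -/
def chainLanguage (R : α → α → Prop) : Language α := {w | w.IsChain R}

theorem append_cons_mem_chainLanguage {R : α → α → Prop} {x w : List α} {a : α} :
    x ++ a :: w ∈ chainLanguage R ↔ x ++ [a] ∈ chainLanguage R ∧ a :: w ∈ chainLanguage R :=
  List.isChain_split

theorem factorsThroughProp_transition_chainLanguage (R : α → α → Prop) (a : α) :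
    FactorsThroughProp (transition (chainLanguage R) a) := by
  let L := chainLanguage R
  refine .of_forall_eq_bot_or_eq (t := transition L a ⟨L, LD_subset_SLD L ⟨[], rfl⟩⟩) ?_
  rintro ⟨_, F, hfin, hF, rfl⟩
  by_cases hx : ∃ x, L.leftQuotient x ∈ F ∧ x ++ [a] ∈ L
  · obtain ⟨x, hxF, hxa⟩ := hx
    refine Or.inr (Subtype.ext (Language.ext fun w => (mem_sSup_language F _).trans ⟨?_, ?_⟩))
    · rintro ⟨K, hK, hw⟩
      obtain ⟨y, rfl⟩ := hF hK
      exact (append_cons_mem_chainLanguage.1 hw).2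
    · exact fun hw => ⟨_, hxF, append_cons_mem_chainLanguage.2 ⟨hxa, hw⟩⟩
  · refine Or.inl (Subtype.ext (Set.eq_empty_of_forall_notMem fun w hw => hx ?_))
    obtain ⟨K, hK, hw⟩ := (mem_sSup_language F _).1 hw
    obtain ⟨x, rfl⟩ := hF hK
    exact ⟨x, hK, (append_cons_mem_chainLanguage.1 hw).1⟩

theorem latticeLanguage_eq_chainLanguage (S : Type*) [SemilatticeSup S] :
    latticeLanguage S = chainLanguage fun p q => ∀ (j : joinIrreducibles S)
      (m : meetIrreducibles S), (j : S) ≤ m → ¬(p = Sum.inl j ∧ q = Sum.inr m) := by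
  ext w
  refine Iff.trans ?_ List.isChain_iff_forall_rel_of_append_cons_cons.symm
  constructor
  · rintro h p q x y rfl j m hjm ⟨rfl, rfl⟩
    exact h j m hjm ⟨x, y, by simp⟩
  · rintro h j m hjm ⟨x, y, hw⟩
    exact h (l₁ := x) (l₂ := y) (by rw [← hw]; simp) j m hjm ⟨rfl, rfl⟩

theorem factorsThroughProp_transition_latticeLanguage (S : Type*) [SemilatticeSup S]
    (a : LatticeAlphabet S) : FactorsThroughProp (transition (latticeLanguage S) a) := by
  rw [latticeLanguage_eq_chainLanguage]
  exact factorsThroughProp_transition_chainLanguage _ a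

end ChainLanguages

end SubatomicNFA

open SubatomicNFA in
theorem mainTheorem5_general :
    (∀ (α : Type*) (L : Language α), IsNuclear L →
      ns L = bipartiteDim (DR L) ∧ bipartiteDim (DR L) ≠ ⊤) ∧
    (∀ (S : Type*) [SemilatticeSup S],
      nAtomic (latticeLanguage S) = nSyntactic (latticeLanguage S) ∧
      nSyntactic (latticeLanguage S) = ns (latticeLanguage S) ∧
      ns (latticeLanguage S) = bipartiteDim (DR (latticeLanguage S)) ∧
      (Finite (LatticeAlphabet S) → bipartiteDim (DR (latticeLanguage S)) ≠ ⊤)) := by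
  refine ⟨fun α L ⟨hreg, hnuc⟩ => ⟨?_, ?_⟩, fun S _ => ?_⟩
  · exact (ns_le_bipartiteDim_DR hnuc).antisymm (bipartiteDim_DR_le_ns L)
  · exact bipartiteDim_DR_ne_top hreg.finite_range_leftQuotient
  · have hrank := factorsThroughProp_transition_latticeLanguage S
    have dim_le_ns := bipartiteDim_DR_le_ns (latticeLanguage S)
    have ns_le_syn := ns_le_nSyntactic (latticeLanguage S)
    have syn_le_at := nSyntactic_le_nAtomic (latticeLanguage S)
    have at_le_dim := nAtomic_le_bipartiteDim_DR hrank
    exact ⟨(at_le_dim.trans (dim_le_ns.trans ns_le_syn)).antisymm syn_le_at,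
      (syn_le_at.trans (at_le_dim.trans dim_le_ns)).antisymm ns_le_syn,
      (ns_le_syn.trans (syn_le_at.trans at_le_dim)).antisymm dim_le_ns,
      fun _ => bipartiteDim_DR_ne_top
        (finite_LD_of_finite_range_transition fun a => (hrank a).finite_range)⟩

theorem mainTheorem5 :
    (∀ (α : Type*) [Finite α] (L : Language α), SubatomicNFA.IsNuclear L →
      SubatomicNFA.ns L = SubatomicNFA.bipartiteDim (SubatomicNFA.DR L) ∧
      SubatomicNFA.bipartiteDim (SubatomicNFA.DR L) ≠ ⊤) ∧
    (∀ (S : Type*) [SemilatticeSup S] [OrderBot S] [Finite S],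
      SubatomicNFA.nAtomic (SubatomicNFA.latticeLanguage S) =
        SubatomicNFA.nSyntactic (SubatomicNFA.latticeLanguage S) ∧
      SubatomicNFA.nSyntactic (SubatomicNFA.latticeLanguage S) =
        SubatomicNFA.ns (SubatomicNFA.latticeLanguage S) ∧
      SubatomicNFA.ns (SubatomicNFA.latticeLanguage S) =
        SubatomicNFA.bipartiteDim (SubatomicNFA.DR (SubatomicNFA.latticeLanguage S)) ∧
      SubatomicNFA.bipartiteDim (SubatomicNFA.DR (SubatomicNFA.latticeLanguage S)) ≠ ⊤) := by
  refine ⟨fun α _ => mainTheorem5_general.{_, 0}.1 α, fun S _ _ _ => ?_⟩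
  obtain ⟨hat, hsyn, hns, hfin⟩ := mainTheorem5_general.{0, _}.2 S
  exact ⟨hat, hsyn, hns, hfin inferInstance⟩
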